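/- Let $k\ge 1$, let ${\bf n}=(n_1,\dots,n_k)$ with $n_i\ge 1$, and let $\mathcal H$ be a complex Hilbert space. For each $i$ let $q_i=\sum_\alpha a_{i,\alpha}Z_\alpha\in\mathbb C\langle Z_1,\dots,Z_{n_i}\rangle$ be a positive regular polynomial in noncommuting indeterminates: $a_{i,\alpha}\ge 0$ for all words $\alpha$, the constant term is zero, and the coefficients of $Z_1,\dots,Z_{n_i}$ are nonzero. For $A\in B(\mathcal H)^{n_i}$ let $\Phi_{q_i,A}(Y)=\sum_\alpha a_{i,\alpha}A_\alpha YA_\alpha^*$, where $A_\alpha=A_{j_1}\cdots A_{j_p}$ for $\alpha=g_{j_1}\cdots g_{j_p}$. Let $B(\mathcal H)^{n_1}\times_c\cdots\times_cB(\mathcal H)^{n_k}$ be the set of all ${\bf X}=(X_1,\dots,X_k)$, $X_i=(X_{i,1},\dots,X_{i,n_i})\in B(\mathcal H)^{n_i}$, such that the entries of $X_s$ commute with the entries of $X_t$ whenever $s\ne t$. For ${\bf p}\in\mathbb Z_+^k$ put ${\bf \Delta}^{\bf p}_{{\bf q},{\bf X}}=(\mathrm{id}-\Phi_{q_1,X_1})^{p_1}\circ\cdots\circ(\mathrm{id}-\Phi_{q_k,X_k})^{p_k}$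 and ${\bf \Delta}_{{\bf q},{\bf X}}={\bf \Delta}^{(1,\dots,1)}_{{\bf q},{\bf X}}$. Define $${\bf D}_{\bf q}^-(\mathcal H)=\{{\bf X}\in B(\mathcal H)^{n_1}\times_c\cdots\times_cB(\mathcal H)^{n_k}:\ {\bf \Delta}^{\bf p}_{{\bf q},{\bf X}}(I)\ge 0\text{ for all }{\bf p}\in\{0,1\}^k\},$$ $${\bf D}_{\bf q}(\mathcal H)=\{{\bf X}\in{\bf D}_{\bf q}^-(\mathcal H):\ {\bf \Delta}_{{\bf q},{\bf X}}(I)\text{ is positive and invertible}\},$$ and let ${\bf D}_{\bf q}(\mathcal H)^-$ denote the closure of ${\bf D}_{\bf q}(\mathcal H)$ in the operator norm topology. For ${\bf z}=(z_{i,j})\in\mathbb C^{n_1+\cdots+n_k}$ put ${\bf zX}=(z_{i,j}X_{i,j})$. A set $G$ of tuples is a complete Reinhardt set if ${\bf zX}\in G$ for all ${\bf X}\in G$ and ${\bf z}\in\overline{\mathbb D}^{n_1+\cdots+n_k}$, where $\mathbb D$ is the open unit disc; it is a complete Reinhardt domain if it is moreover connected, nonempty and relatively open in $B(\mathcal H)^{n_1}\times_c\cdots\times_cB(\mathcal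 H)^{n_k}$. Then: (i) ${\bf D}_{\bf q}(\mathcal H)$ is relatively open in $B(\mathcal H)^{n_1}\times_c\cdots\times_cB(\mathcal H)^{n_k}$, and ${\bf D}_{\bf q}(\mathcal H)^-={\bf D}_{\bf q}^-(\mathcal H)$. (ii) ${\bf D}_{\bf q}(\mathcal H)$ is a complete Reinhardt domain, and $${\bf D}_{\bf q}(\mathcal H)=\bigcup_{{\bf z}\in\overline{\mathbb D}^{n_1+\cdots+n_k}}{\bf z}{\bf D}_{\bf q}(\mathcal H)=\bigcup_{{\bf z}\in\mathbb D^{n_1+\cdots+n_k}}{\bf z}{\bf D}_{\bf q}(\mathcal H)^-=\bigcup_{{\bf z}\in\mathbb D^{n_1+\cdots+n_k}}{\bf z}{\bf D}_{\bf q}(\mathcal H),$$ $${\bf D}_{\bf q}(\mathcal H)=\bigcup_{0\le r<1}r{\bf D}_{\bf q}(\mathcal H)=\bigcup_{0\le r<1}r{\bf D}_{\bf q}(\mathcal H)^-.$$ (iii) ${\bf D}_{\bf q}(\mathcal H)^-$ is a complete Reinhardt set, and $${\bf D}_{\bf q}(\mathcal H)^-=\bigcup_{{\bf z}\in\overline{\mathbb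 D}^{n_1+\cdots+n_k}}{\bf z}{\bf D}_{\bf q}(\mathcal H)^-=\bigcup_{0\le r\le 1}r{\bf D}_{\bf q}(\mathcal H)^-.$$ -/

import Mathlib

open scoped ComplexOrder Pointwise

noncomputable section

namespace RegularPolydomain

/-- The algebra `ℂ⟨Z₁, …, Zₙ⟩` of polynomials in `n` noncommuting indeterminates, i.e. the
monoid algebra of the free monoid (of words) on `n` letters. -/
abbrev NCPoly (n : ℕ) : Type := MonoidAlgebra ℂ (FreeMonoid (Fin n))

/-- The coefficient `a_α` of the word `α`. -/
def coeff {n : ℕ} (q : NCPoly n) (α : FreeMonoid (Fin n)) : ℂ := q.coeff α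

/-- The finite set of words that occur in `q`. -/
def words {n : ℕ} (q : NCPoly n) : Finset (FreeMonoid (Fin n)) := q.coeff.support

/-- Positive regular polynomials: the coefficients are nonnegative reals (that is, those that
occur are positive), the constant term is zero, and the coefficients of the linear terms are
nonzero.  The order on `ℂ` makes `0 ≤ a` say that `a` is real and nonnegative. -/
structure IsPositiveRegular {n : ℕ} (q : NCPoly n) : Prop where
  nonneg : ∀ α, 0 ≤ coeff q α
  constant : coeff q 1 = 0
  linear : ∀ j : Fin n, coeff q (FreeMonoid.of j) ≠ 0

section Operators

variable {H : Type*} [NormedAddCommGroup H] [InnerProductSpace ℂ H] [CompleteSpace H]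

/-- `X_α = X_{j₁} ⋯ X_{j_p}` for a word `α = g_{j₁} ⋯ g_{j_p}`, with `X_{g₀} = I`. -/
def wordOp {n : ℕ} (A : Fin n → (H →L[ℂ] H)) (α : FreeMonoid (Fin n)) : H →L[ℂ] H :=
  FreeMonoid.lift A α

/-- The linear map `Φ_{q,A} : B(H) → B(H)`, `Y ↦ ∑_α a_α A_α Y A_α*`. -/
def phi {n : ℕ} (q : NCPoly n) (A : Fin n → (H →L[ℂ] H)) : Module.End ℂ (H →L[ℂ] H) :=
  ∑ α ∈ words q, coeff q α •
    LinearMap.mulLeftRight ℂ (wordOp A α, ContinuousLinearMap.adjoint (wordOp A α))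

theorem phi_apply {n : ℕ} (q : NCPoly n) (A : Fin n → (H →L[ℂ] H)) (Y : H →L[ℂ] H) :
    phi q A Y = ∑ α ∈ words q, coeff q α •
      (wordOp A α * Y * ContinuousLinearMap.adjoint (wordOp A α)) := by
  simp [phi, LinearMap.sum_apply]

end Operators

/-- `B(H)^{n₁} × ⋯ × B(H)^{n_k}`; as a product of copies of `B(H)` with the operator norm it
carries the (product) operator norm topology. -/
abbrev Tuple {k : ℕ} (n : Fin k → ℕ) (H : Type*) [NormedAddCommGroup H]
    [InnerProductSpace ℂ H] : Type _ :=
  (i : Fin k) → Fin (n i) → (H →L[ℂ] H)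

section Polydomain

variable {k : ℕ} {n : Fin k → ℕ}
variable (H : Type*) [NormedAddCommGroup H] [InnerProductSpace ℂ H] [CompleteSpace H]

variable (n) in
/-- `B(H)^{n₁} ×_c ⋯ ×_c B(H)^{n_k}`: for `s ≠ t` the entries of `X_s` commute with those
of `X_t`. -/
def commutingTuples : Set (Tuple n H) :=
  {X | ∀ s t : Fin k, s ≠ t → ∀ (a : Fin (n s)) (b : Fin (n t)), Commute (X s a) (X t b)}

variable {H} in
/-- The defect mapping
`Δ_{q,X}^p = (id - Φ_{q₁,X₁})^{p₁} ∘ ⋯ ∘ (id - Φ_{q_k,X_k})^{p_k}` on `B(H)`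
(multiplication in `Module.End` is composition). -/
def defect (q : (i : Fin k) → NCPoly (n i)) (X : Tuple n H) (p : Fin k → ℕ) :
    Module.End ℂ (H →L[ℂ] H) :=
  (List.ofFn fun i => (1 - phi (q i) (X i)) ^ p i).prod

/-- `D_q^-(H)`: the commuting tuples with `Δ_{q,X}^p(I) ≥ 0` for all `p ∈ {0,1}^k`. -/
def closedPolydomain (q : (i : Fin k) → NCPoly (n i)) : Set (Tuple n H) :=
  {X | X ∈ commutingTuples n H ∧
    ∀ p : Fin k → ℕ, (∀ i, p i ≤ 1) → 0 ≤ defect q X p 1}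

/-- `D_q(H)`: the tuples in `D_q^-(H)` with `Δ_{q,X}(I) > 0`, i.e. `Δ_{q,X}(I)` positive and
invertible, where `Δ_{q,X} = Δ_{q,X}^{(1,…,1)}`. -/
def openPolydomain (q : (i : Fin k) → NCPoly (n i)) : Set (Tuple n H) :=
  {X | X ∈ closedPolydomain H q ∧
    0 ≤ defect q X (fun _ => 1) 1 ∧ IsUnit (defect q X (fun _ => 1) 1)}

variable {H}

/-- `zX = {z_{i,j} X_{i,j}}`. -/
def scale (z : (i : Fin k) → Fin (n i) → ℂ) (X : Tuple n H) : Tuple n H :=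
  fun i j => z i j • X i j

variable (n) in
/-- The open polydisc `𝔻^{n₁ + ⋯ + n_k}`. -/
def openPolydisc : Set ((i : Fin k) → Fin (n i) → ℂ) := {z | ∀ i j, ‖z i j‖ < 1}

variable (n) in
/-- The closed polydisc. -/
def closedPolydisc : Set ((i : Fin k) → Fin (n i) → ℂ) := {z | ∀ i j, ‖z i j‖ ≤ 1}

/-- Complete Reinhardt sets of tuples. -/
def IsCompleteReinhardt (G : Set (Tuple n H)) : Prop :=
  ∀ X ∈ G, ∀ z ∈ closedPolydisc n, scale z X ∈ G

/-- `G` is a relatively open subset of `C`. -/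
def IsRelOpen {T : Type*} [TopologicalSpace T] (C G : Set T) : Prop :=
  ∃ U : Set T, IsOpen U ∧ G = U ∩ C

/-- Complete Reinhardt domains in the space of commuting tuples: (nonempty) connected,
relatively open, complete Reinhardt sets. -/
def IsCompleteReinhardtDomain (G : Set (Tuple n H)) : Prop :=
  IsRelOpen (commutingTuples n H) G ∧ IsConnected G ∧ IsCompleteReinhardt G

end Polydomain

end RegularPolydomain

end

/-! Everything rests on two order estimates for commuting maps `P i` whose defects `∏ (1 - P i) ^ p
i`, `p ∈ {0,1}^k`, are all nonnegative at a vector `Y`. Scaling (`smul_le_prod_ofFn`): multiplying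
the entries of `X` by scalars of modulus at most `ρ ≤ 1` replaces each `Φ_i` by a map dominated by
`ρ Φ_i` on the positive cone, since there is no constant term. The defects at `I` are then at least
`(1 - ρ) ^ k`. With `ρ = 1` this makes `D_q^-` a Reinhardt set; with `ρ < 1` it sends `D_q^-` into
`D_q`. Monotonicity (`prod_ofFn_one_le`): if the `P i` are positive, the full defect is the
smallest. At a point of `D_q` one bound `Δ(I) ≥ c > 0` thus bounds all defects below, and by norm
continuity the finitely many bounds survive nearby; so `D_q` is relatively open. The closure formula
follows from `rX → X` as `r ↑ 1`. Openness puts `r⁻¹X` in `D_q` for some `r < 1`, which gives the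
unions and the Reinhardt property of `D_q`. Connectedness holds because `D_q` is star-shaped about
`0`. -/

namespace RegularPolydomain

/-! ### Defect products of commuting maps on an ordered module. -/

section OrderedModule

variable {R E : Type*} [Ring R] [AddCommGroup E] [Module R E]

theorem prod_ofFn_apply_succ {k : ℕ} (P : Fin (k + 1) → Module.End R E) (p : Fin (k + 1) → ℕ)
    (Y : E) :
    (List.ofFn fun i => (1 - P i) ^ p i).prod Y =
      ((1 - P 0) ^ p 0) ((List.ofFn fun i : Fin k => (1 - P i.succ) ^ p i.succ).prod Y) := by
  rw [List.ofFn_succ, List.prod_cons, Module.End.mul_apply]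

theorem commute_pow_prod_ofFn {k : ℕ} (A : Module.End R E) (P : Fin k → Module.End R E)
    (h : ∀ i, Commute A (P i)) (m : ℕ) (p : Fin k → ℕ) :
    Commute ((1 - A) ^ m) (List.ofFn fun i => (1 - P i) ^ p i).prod := by
  refine Commute.list_prod_right _ _ fun B hB => ?_
  obtain ⟨i, rfl⟩ := List.mem_ofFn.1 hB
  exact (((Commute.one_right _).sub_right
    ((Commute.one_left _).sub_left (h i))).pow_pow _ _)

theorem prod_ofFn_apply_apply {k : ℕ} {A : Module.End R E} {P : Fin k → Module.End R E}
    (h : ∀ i, Commute A (P i)) (m : ℕ) (p : Fin k → ℕ) (Y : E) :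
    (List.ofFn fun i => (1 - P i) ^ p i).prod (((1 - A) ^ m) Y) =
      ((1 - A) ^ m) ((List.ofFn fun i => (1 - P i) ^ p i).prod Y) := by
  rw [← Module.End.mul_apply, ← (commute_pow_prod_ofFn A P h m p).eq, Module.End.mul_apply]

/-- Moving the zeroth factor innermost turns a defect of `k + 1` maps at `Y` into a defect of the
`k` remaining maps at `(1 - P 0) ^ m Y`. This is why the inductions below generalize over `Y`. -/
theorem prod_ofFn_cons_apply {k : ℕ} {P : Fin (k + 1) → Module.End R E}
    (hP : Pairwise fun i j => Commute (P i) (P j)) (m : ℕ) (p : Fin k → ℕ) (Y : E) :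
    (List.ofFn fun i => (1 - P i) ^ (Fin.cons m p : Fin (k + 1) → ℕ) i).prod Y =
      (List.ofFn fun i : Fin k => (1 - P i.succ) ^ p i).prod (((1 - P 0) ^ m) Y) := by
  rw [prod_ofFn_apply_succ, prod_ofFn_apply_apply fun i => hP (Fin.succ_ne_zero i).symm]
  simp

theorem cons_le_one {k m : ℕ} {p : Fin k → ℕ} (hm : m ≤ 1) (hp : ∀ i, p i ≤ 1)
    (i : Fin (k + 1)) : (Fin.cons m p : Fin (k + 1) → ℕ) i ≤ 1 := by
  induction i using Fin.cases with
  | zero => simpa using hm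
  | succ i => simpa using hp i

variable [PartialOrder E] [IsOrderedAddMonoid E]

/-- If the defects of `P` are nonnegative at `Y`, and `Q i ≤ ρ • P i` on the positive cone,
then the defects of `Q` at `Y` are bounded below by `(1 - ρ) ^ k • Y`. -/
theorem smul_le_prod_ofFn [Module ℝ E] [IsOrderedModule ℝ E] {k : ℕ}
    {P Q : Fin k → Module.End R E} {ρ : ℝ} (hρ₀ : 0 ≤ ρ) (hρ₁ : ρ ≤ 1)
    (hP : Pairwise fun i j => Commute (P i) (P j))
    (hPQ : Pairwise fun i j => Commute (P i) (Q j))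
    (hle : ∀ i W, 0 ≤ W → Q i W ≤ ρ • P i W) {Y : E}
    (hY : ∀ p : Fin k → ℕ, (∀ i, p i ≤ 1) → 0 ≤ (List.ofFn fun i => (1 - P i) ^ p i).prod Y)
    (p : Fin k → ℕ) (hp : ∀ i, p i ≤ 1) :
    (1 - ρ) ^ k • Y ≤ (List.ofFn fun i => (1 - Q i) ^ p i).prod Y := by
  have h1ρ : 0 ≤ 1 - ρ := sub_nonneg.2 hρ₁
  induction k generalizing Y with
  | zero => simp
  | succ k ih =>
    have hcomm : ∀ i : Fin k, Commute (P 0) (Q i.succ) := fun i => hPQ (Fin.succ_ne_zero i).symm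
    -- The induction hypothesis is used at both `Y` and `(1 - P 0) Y`: the first gives a lower bound
    -- for `W` below, the second gives `P 0 W ≤ W`.
    have key : ∀ m ≤ 1, (1 - ρ) ^ k • (((1 - P 0) ^ m) Y) ≤
        ((1 - P 0) ^ m) ((List.ofFn fun i : Fin k => (1 - Q i.succ) ^ p i.succ).prod Y) := by
      intro m hm
      rw [← prod_ofFn_apply_apply hcomm]
      refine ih (fun i j hij => hP (by simpa using hij)) (fun i j hij => hPQ (by simpa using hij))
        (fun i => hle i.succ) (fun p' hp' => ?_) _ (fun i => hp _)
      rw [← prod_ofFn_cons_apply hP]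
      exact hY _ (cons_le_one hm hp')
    have hpos : ∀ m ≤ 1, 0 ≤ ((1 - P 0) ^ m) Y := by
      intro m hm
      have := hY (Fin.cons m fun _ => 0) (cons_le_one hm fun _ => zero_le_one)
      rw [prod_ofFn_cons_apply hP] at this
      simpa using this
    rw [prod_ofFn_apply_succ]
    set W := (List.ofFn fun i : Fin k => (1 - Q i.succ) ^ p i.succ).prod Y with hW
    have hYW : (1 - ρ) ^ k • Y ≤ W := by simpa using key 0 zero_le_one
    have hW₀ : 0 ≤ W :=
      (smul_nonneg (pow_nonneg h1ρ k) (by simpa using hpos 0 zero_le_one)).trans hYW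
    have hPW : P 0 W ≤ W := by
      have h := (smul_nonneg (pow_nonneg h1ρ k) (hpos 1 le_rfl)).trans (key 1 le_rfl)
      simpa using h
    have hstep : (1 - ρ) ^ (k + 1) • Y ≤ (1 - ρ) • W := by
      rw [pow_succ', mul_smul]
      exact smul_le_smul_of_nonneg_left hYW h1ρ
    rcases Nat.le_one_iff_eq_zero_or_eq_one.1 (hp 0) with h | h
    · rw [h, pow_zero, Module.End.one_apply]
      refine hstep.trans ?_
      rw [sub_smul, one_smul]
      exact sub_le_self _ (smul_nonneg hρ₀ hW₀)
    -- Here `Q 0 W ≤ ρ P 0 W ≤ ρ W`, so `(1 - Q 0) W ≥ (1 - ρ) W`.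
    · rw [h, pow_one, LinearMap.sub_apply, Module.End.one_apply]
      refine hstep.trans ?_
      rw [sub_smul, one_smul]
      exact sub_le_sub_left ((hle 0 W hW₀).trans (smul_le_smul_of_nonneg_left hPW hρ₀)) _

/-- For positive commuting maps the full defect is the smallest one. -/
theorem prod_ofFn_one_le {k : ℕ} {P : Fin k → Module.End R E}
    (hP : Pairwise fun i j => Commute (P i) (P j)) (hpos : ∀ i W, 0 ≤ W → 0 ≤ P i W) {Y : E}
    (hY : ∀ p : Fin k → ℕ, (∀ i, p i ≤ 1) → 0 ≤ (List.ofFn fun i => (1 - P i) ^ p i).prod Y)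
    (p : Fin k → ℕ) (hp : ∀ i, p i ≤ 1) :
    (List.ofFn fun i => (1 - P i) ^ (1 : ℕ)).prod Y ≤ (List.ofFn fun i => (1 - P i) ^ p i).prod Y := by
  induction k generalizing Y with
  | zero => simp
  | succ k ih =>
    have hcomm : ∀ i : Fin k, Commute (P 0) (P i.succ) := fun i => hP (Fin.succ_ne_zero i).symm
    have key : ∀ m ≤ 1, ((1 - P 0) ^ m) ((List.ofFn fun i : Fin k => (1 - P i.succ) ^ (1 : ℕ)).prod Y) ≤
        ((1 - P 0) ^ m) ((List.ofFn fun i : Fin k => (1 - P i.succ) ^ p i.succ).prod Y) := by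
      intro m hm
      rw [← prod_ofFn_apply_apply hcomm, ← prod_ofFn_apply_apply hcomm]
      refine ih (fun i j hij => hP (by simpa using hij))
        (fun i => hpos i.succ) (fun p' hp' => ?_) _ (fun i => hp _)
      rw [← prod_ofFn_cons_apply hP]
      exact hY _ (cons_le_one hm hp')
    rw [prod_ofFn_apply_succ P (fun _ => 1), prod_ofFn_apply_succ]
    refine le_trans ?_ (key _ (hp 0))
    rcases Nat.le_one_iff_eq_zero_or_eq_one.1 (hp 0) with h | h
    · rw [h, pow_zero, Module.End.one_apply, pow_one, LinearMap.sub_apply, Module.End.one_apply]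
      refine sub_le_self _ (hpos 0 _ ?_)
      have := hY (Fin.cons 0 fun _ => 1) (cons_le_one zero_le_one fun _ => le_rfl)
      rw [prod_ofFn_cons_apply hP] at this
      simpa using this
    · rw [h]

end OrderedModule

/-- Continuity of `P i X (f X)` is asked for every continuous `f`, because in a composition the
inner argument also varies with `X`. -/
theorem continuous_prod_ofFn_apply {R E T : Type*} [Ring R] [AddCommGroup E] [Module R E]
    [TopologicalSpace E] [IsTopologicalAddGroup E] [TopologicalSpace T] {k : ℕ}
    (P : Fin k → T → Module.End R E)
    (hP : ∀ i, ∀ f : T → E, Continuous f → Continuous fun X => P i X (f X))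
    (p : Fin k → ℕ) {f : T → E} (hf : Continuous f) :
    Continuous fun X => (List.ofFn fun i => (1 - P i X) ^ p i).prod (f X) := by
  induction k generalizing f with
  | zero => simpa using hf
  | succ k ih =>
    have hpow : ∀ (m : ℕ) {g : T → E}, Continuous g →
        Continuous fun X => ((1 - P 0 X) ^ m) (g X) := by
      intro m
      induction m with
      | zero => intro g hg; simpa using hg
      | succ m ihm =>
        intro g hg
        simp only [pow_succ, Module.End.mul_apply, LinearMap.sub_apply, Module.End.one_apply]
        exact ihm (hg.sub (hP 0 g hg))
    simp only [fun X => prod_ofFn_apply_succ fun i => P i X]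
    exact hpow _ (ih _ (fun i => hP i.succ) _ hf)

/-! ### Word operators and the maps `Φ_{q,A}`. -/

section Operators

variable {H : Type*} [NormedAddCommGroup H] [InnerProductSpace ℂ H]

theorem wordOp_eq_prod {n : ℕ} (A : Fin n → (H →L[ℂ] H)) (α : FreeMonoid (Fin n)) :
    wordOp A α = (α.toList.map A).prod :=
  FreeMonoid.lift_apply A α

theorem wordOp_smul {n : ℕ} (z : Fin n → ℂ) (A : Fin n → (H →L[ℂ] H)) (α : FreeMonoid (Fin n)) :
    wordOp (fun j => z j • A j) α = FreeMonoid.lift z α • wordOp A α := by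
  induction α using FreeMonoid.inductionOn' with
  | one => simp [wordOp]
  | of_mul j α ih =>
    simp only [wordOp, map_mul, FreeMonoid.lift_eval_of] at ih ⊢
    rw [ih, smul_mul_smul_comm]

theorem norm_lift_le_one {n : ℕ} {z : Fin n → ℂ} (hz : ∀ j, ‖z j‖ ≤ 1)
    (α : FreeMonoid (Fin n)) : ‖FreeMonoid.lift z α‖ ≤ 1 := by
  induction α using FreeMonoid.inductionOn' with
  | one => simp
  | of_mul j α ih =>
    rw [map_mul, FreeMonoid.lift_eval_of, norm_mul]
    exact mul_le_one₀ (hz j) (norm_nonneg _) ih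

theorem norm_lift_le {n : ℕ} {z : Fin n → ℂ} {ρ : ℝ} (hρ : ρ ≤ 1) (hz : ∀ j, ‖z j‖ ≤ ρ)
    {α : FreeMonoid (Fin n)} (hα : α ≠ 1) : ‖FreeMonoid.lift z α‖ ≤ ρ := by
  induction α using FreeMonoid.inductionOn' with
  | one => exact absurd rfl hα
  | of_mul j α _ =>
    rw [map_mul, FreeMonoid.lift_eval_of, norm_mul]
    exact (mul_le_of_le_one_right (norm_nonneg _)
      (norm_lift_le_one (fun j => (hz j).trans hρ) α)).trans (hz j)

theorem commute_wordOp {m n : ℕ} {A : Fin m → (H →L[ℂ] H)} {B : Fin n → (H →L[ℂ] H)}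
    (h : ∀ a b, Commute (A a) (B b)) (α : FreeMonoid (Fin m)) (β : FreeMonoid (Fin n)) :
    Commute (wordOp A α) (wordOp B β) := by
  rw [wordOp_eq_prod, wordOp_eq_prod]
  refine Commute.list_prod_left _ _ fun S hS => Commute.list_prod_right _ _ fun T hT => ?_
  obtain ⟨a, -, rfl⟩ := List.mem_map.1 hS
  obtain ⟨b, -, rfl⟩ := List.mem_map.1 hT
  exact h a b

variable [CompleteSpace H]

/-- Words multiply `Y` on the left and their adjoints on the right, so entries of `A` never have to
commute with adjoints of entries of `B`. -/
theorem commute_phi {m n : ℕ} (q : NCPoly m) (r : NCPoly n) {A : Fin m → (H →L[ℂ] H)}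
    {B : Fin n → (H →L[ℂ] H)} (h : ∀ a b, Commute (A a) (B b)) :
    Commute (phi q A) (phi r B) := by
  refine Commute.sum_left _ _ _ fun α _ => Commute.sum_right _ _ _ fun β _ =>
    Commute.smul_left (Commute.smul_right ?_ _) _
  have hc := commute_wordOp h α β
  have hc' : Commute (ContinuousLinearMap.adjoint (wordOp A α))
      (ContinuousLinearMap.adjoint (wordOp B β)) := hc.star_star
  ext1 Y
  simp only [Module.End.mul_apply, LinearMap.mulLeftRight_apply, mul_assoc]
  rw [← hc'.eq]
  simp only [← mul_assoc]
  rw [hc.eq]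

theorem phi_nonneg {n : ℕ} {q : NCPoly n} (hq : IsPositiveRegular q) (A : Fin n → (H →L[ℂ] H))
    {Y : H →L[ℂ] H} (hY : 0 ≤ Y) : 0 ≤ phi q A Y := by
  rw [phi_apply]
  exact Finset.sum_nonneg fun α _ =>
    smul_nonneg (hq.nonneg α) (star_right_conjugate_nonneg hY (wordOp A α))

theorem phi_smul_le {n : ℕ} {q : NCPoly n} (hq : IsPositiveRegular q) (A : Fin n → (H →L[ℂ] H))
    {z : Fin n → ℂ} {ρ : ℝ} (hρ : ρ ≤ 1) (hz : ∀ j, ‖z j‖ ≤ ρ)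
    {Y : H →L[ℂ] H} (hY : 0 ≤ Y) : phi q (fun j => z j • A j) Y ≤ ρ • phi q A Y := by
  rw [phi_apply, phi_apply, Finset.smul_sum]
  refine Finset.sum_le_sum fun α hα => ?_
  have hα1 : α ≠ 1 := by
    rintro rfl
    exact (Finsupp.mem_support_iff.1 hα) hq.constant
  -- A nonempty word has a letter of modulus at most `ρ`; squaring only helps because `ρ ≤ 1`.
  have hnorm : ‖FreeMonoid.lift z α‖ ^ 2 ≤ ρ := by
    have h := norm_lift_le hρ hz hα1
    nlinarith [norm_nonneg (FreeMonoid.lift z α)]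
  rw [smul_comm ρ]
  refine smul_le_smul_of_nonneg_left ?_ (hq.nonneg α)
  have heq : wordOp (fun j => z j • A j) α * Y *
      ContinuousLinearMap.adjoint (wordOp (fun j => z j • A j) α) =
      (‖FreeMonoid.lift z α‖ ^ 2) •
        (wordOp A α * Y * ContinuousLinearMap.adjoint (wordOp A α)) := by
    rw [wordOp_smul, ← ContinuousLinearMap.star_eq_adjoint, ← ContinuousLinearMap.star_eq_adjoint,
      star_smul, smul_mul_assoc, smul_mul_smul_comm, ← Complex.coe_smul]
    congr 1
    simpa using Complex.mul_conj' (FreeMonoid.lift z α)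
  rw [heq]
  exact smul_le_smul_of_nonneg_right hnorm (star_right_conjugate_nonneg hY (wordOp A α))

theorem phi_isSelfAdjoint {n : ℕ} {q : NCPoly n} (hq : IsPositiveRegular q)
    (A : Fin n → (H →L[ℂ] H)) {Y : H →L[ℂ] H} (hY : IsSelfAdjoint Y) :
    IsSelfAdjoint (phi q A Y) := by
  rw [phi_apply]
  exact isSelfAdjoint_sum _ fun α _ =>
    (IsSelfAdjoint.of_nonneg (hq.nonneg α)).smul (hY.conjugate (wordOp A α))

theorem continuous_phi_apply {T : Type*} [TopologicalSpace T] {n : ℕ} (q : NCPoly n)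
    {A : T → Fin n → (H →L[ℂ] H)} (hA : Continuous A) {f : T → (H →L[ℂ] H)} (hf : Continuous f) :
    Continuous fun X => phi q (A X) (f X) := by
  have hw : ∀ α : FreeMonoid (Fin n), Continuous fun X => wordOp (A X) α := fun α => by
    simp only [wordOp_eq_prod]
    exact continuous_list_prod _ fun j _ => (continuous_apply j).comp hA
  have hw' : ∀ α : FreeMonoid (Fin n),
      Continuous fun X => ContinuousLinearMap.adjoint (wordOp (A X) α) :=
    fun α => ContinuousLinearMap.adjoint.continuous.comp (hw α)
  simp only [phi_apply]
  fun_prop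

end Operators

/-! ### Strict positivity as a scalar lower bound. -/

theorem isStrictlyPositive_of_smul_one_le {A : Type*} [CStarAlgebra A] [PartialOrder A]
    [StarOrderedRing A] {c : ℝ} (hc : 0 < c) {a : A} (h : c • (1 : A) ≤ a) :
    IsStrictlyPositive a :=
  (isStrictlyPositive_one.smul hc).of_le h

theorem exists_smul_one_le {A : Type*} [CStarAlgebra A] [PartialOrder A]
    [StarOrderedRing A] {a : A} (ha : IsStrictlyPositive a) : ∃ c : ℝ, 0 < c ∧ c • (1 : A) ≤ a := by
  -- The zero algebra, which occurs for `H = 0`, has empty spectrum and is treated apart.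
  rcases subsingleton_or_nontrivial A
  · exact ⟨1, one_pos, (Subsingleton.elim _ _).le⟩
  · obtain ⟨r, hr, h⟩ := (CFC.exists_pos_algebraMap_le_iff ha.isSelfAdjoint).2
      fun x hx => ha.spectrum_pos hx
    exact ⟨r, hr, by rwa [← Algebra.algebraMap_eq_smul_one]⟩

/-! ### Topology and scaling of the polydomains. -/

section Polydomain

variable {k : ℕ} {n : Fin k → ℕ}
variable {H : Type*} [NormedAddCommGroup H] [InnerProductSpace ℂ H]

theorem scale_mem_commutingTuples {X : Tuple n H} (hX : X ∈ commutingTuples n H)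
    (z : (i : Fin k) → Fin (n i) → ℂ) : scale z X ∈ commutingTuples n H :=
  fun s t hst a b => ((hX s t hst a b).smul_left _).smul_right _

theorem scale_scale (w z : (i : Fin k) → Fin (n i) → ℂ) (X : Tuple n H) :
    scale w (scale z X) = scale (w * z) X := by
  ext1 i; ext1 j
  simp [scale, mul_smul]

theorem scale_one (X : Tuple n H) : scale 1 X = X := by
  ext1 i; ext1 j
  simp [scale]

theorem smul_eq_scale (c : ℂ) (X : Tuple n H) : c • X = scale (fun _ _ => c) X := rfl

theorem isClosed_commutingTuples : IsClosed (commutingTuples n H) := by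
  simp only [commutingTuples, Set.ofPred_forall]
  refine isClosed_iInter fun s => isClosed_iInter fun t => isClosed_iInter fun _ =>
    isClosed_iInter fun a => isClosed_iInter fun b => ?_
  exact isClosed_eq (by fun_prop) (by fun_prop)

theorem IsCompleteReinhardt.eq_biUnion_scale {G : Set (Tuple n H)} (hG : IsCompleteReinhardt G) :
    G = ⋃ z ∈ closedPolydisc n, scale z '' G := by
  refine Set.Subset.antisymm (fun X hX => Set.mem_biUnion (x := 1) (fun _ _ => by simp)
    ⟨X, hX, scale_one X⟩) (Set.iUnion₂_subset fun z hz => ?_)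
  rintro _ ⟨X, hX, rfl⟩
  exact hG X hX z hz

theorem IsCompleteReinhardt.eq_biUnion_smul {G : Set (Tuple n H)} (hG : IsCompleteReinhardt G) :
    G = ⋃ r ∈ Set.Icc (0 : ℝ) 1, (r : ℂ) • G := by
  refine Set.Subset.antisymm (fun X hX => Set.mem_biUnion (x := 1) ⟨zero_le_one, le_rfl⟩
    ⟨X, hX, by simp⟩) (Set.iUnion₂_subset fun r hr => ?_)
  rintro _ ⟨X, hX, rfl⟩
  exact hG X hX (fun _ _ => (r : ℂ)) fun _ _ => by simpa [abs_of_nonneg hr.1] using hr.2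

variable [CompleteSpace H] {q : (i : Fin k) → NCPoly (n i)}

theorem pairwise_commute_phi (q : (i : Fin k) → NCPoly (n i)) {X : Tuple n H}
    (hX : X ∈ commutingTuples n H) :
    Pairwise fun i j => Commute (phi (q i) (X i)) (phi (q j) (X j)) :=
  fun i j hij => commute_phi _ _ (hX i j hij)

theorem smul_le_defect_scale (hq : ∀ i, IsPositiveRegular (q i)) {X : Tuple n H}
    (hX : X ∈ closedPolydomain H q) {ρ : ℝ} (hρ₀ : 0 ≤ ρ) (hρ₁ : ρ ≤ 1)
    {z : (i : Fin k) → Fin (n i) → ℂ} (hz : ∀ i j, ‖z i j‖ ≤ ρ) (p : Fin k → ℕ)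
    (hp : ∀ i, p i ≤ 1) : (1 - ρ) ^ k • (1 : H →L[ℂ] H) ≤ defect q (scale z X) p 1 :=
  smul_le_prod_ofFn hρ₀ hρ₁ (pairwise_commute_phi q hX.1)
    (fun i j hij => commute_phi _ _ fun a b => (hX.1 i j hij a b).smul_right _)
    (fun i _ hW => phi_smul_le (hq i) (X i) hρ₁ (hz i) hW) hX.2 p hp

theorem scale_mem_closedPolydomain (hq : ∀ i, IsPositiveRegular (q i)) {X : Tuple n H}
    (hX : X ∈ closedPolydomain H q) {z : (i : Fin k) → Fin (n i) → ℂ}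
    (hz : z ∈ closedPolydisc n) : scale z X ∈ closedPolydomain H q :=
  ⟨scale_mem_commutingTuples hX.1 z, fun p hp => le_trans
    (smul_nonneg (by simp) zero_le_one) (smul_le_defect_scale hq hX zero_le_one le_rfl hz p hp)⟩

theorem exists_norm_le_of_mem_openPolydisc {z : (i : Fin k) → Fin (n i) → ℂ}
    (hz : z ∈ openPolydisc n) : ∃ ρ : ℝ, 0 ≤ ρ ∧ ρ < 1 ∧ ∀ i j, ‖z i j‖ ≤ ρ :=
  ⟨‖z‖, norm_nonneg _, (pi_norm_lt_iff one_pos).2 fun i => (pi_norm_lt_iff one_pos).2 (hz i),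
    fun i j => (norm_le_pi_norm (z i) j).trans (norm_le_pi_norm z i)⟩

theorem scale_mem_openPolydomain_of_mem_closedPolydomain (hq : ∀ i, IsPositiveRegular (q i))
    {X : Tuple n H} (hX : X ∈ closedPolydomain H q) {z : (i : Fin k) → Fin (n i) → ℂ}
    (hz : z ∈ openPolydisc n) : scale z X ∈ openPolydomain H q := by
  obtain ⟨ρ, hρ₀, hρ₁, hzρ⟩ := exists_norm_le_of_mem_openPolydisc hz
  exact ⟨scale_mem_closedPolydomain hq hX fun i j => (hz i j).le,
    isStrictlyPositive_of_smul_one_le (pow_pos (sub_pos.2 hρ₁) k)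
      (smul_le_defect_scale hq hX hρ₀ hρ₁.le hzρ _ fun _ => le_rfl)⟩

theorem continuous_phi_eval (q : (i : Fin k) → NCPoly (n i)) (i : Fin k)
    {f : Tuple n H → (H →L[ℂ] H)} (hf : Continuous f) :
    Continuous fun X => phi (q i) (X i) (f X) :=
  continuous_phi_apply (T := Tuple n H) (A := fun X => X i) (q i) (continuous_apply i) hf

theorem continuous_defect (q : (i : Fin k) → NCPoly (n i)) (p : Fin k → ℕ) :
    Continuous fun X : Tuple n H => defect q X p 1 := by
  have h1 : Continuous fun _ : Tuple n H => (1 : H →L[ℂ] H) := continuous_const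
  have h := continuous_prod_ofFn_apply (T := Tuple n H) (fun i X => phi (q i) (X i))
    (fun i f hf => continuous_phi_eval q i hf) p h1
  simp only [defect]
  exact h

theorem defect_isSelfAdjoint (hq : ∀ i, IsPositiveRegular (q i)) (X : Tuple n H)
    (p : Fin k → ℕ) : IsSelfAdjoint (defect q X p 1) := by
  unfold defect
  generalize hl : (List.ofFn fun i => (1 - phi (q i) (X i)) ^ p i) = l
  have h : ∀ F ∈ l, ∀ Y, IsSelfAdjoint Y → IsSelfAdjoint (F Y) := by
    subst hl
    intro F hF
    obtain ⟨i, rfl⟩ := List.mem_ofFn.1 hF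
    induction p i with
    | zero => simp
    | succ m ih =>
      intro Y hY
      rw [pow_succ, Module.End.mul_apply]
      exact ih _ (hY.sub (phi_isSelfAdjoint (hq i) (X i) hY))
  clear hl
  induction l with
  | nil => simp
  | cons F l ih =>
    rw [List.prod_cons, Module.End.mul_apply]
    exact h F (by simp) _ (ih fun G hG => h G (by simp [hG]))

theorem defect_one_le (hq : ∀ i, IsPositiveRegular (q i)) {X : Tuple n H}
    (hX : X ∈ closedPolydomain H q) (p : Fin k → ℕ) (hp : ∀ i, p i ≤ 1) :
    defect q X (fun _ => 1) 1 ≤ defect q X p 1 :=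
  prod_ofFn_one_le (pairwise_commute_phi q hX.1) (fun i _ hW => phi_nonneg (hq i) (X i) hW)
    hX.2 p hp

theorem isClosed_closedPolydomain : IsClosed (closedPolydomain H q) := by
  have : closedPolydomain H q = commutingTuples n H ∩
      ⋂ p : Fin k → ℕ, ⋂ _ : ∀ i, p i ≤ 1, {X | 0 ≤ defect q X p 1} := by
    ext X; simp [closedPolydomain]
  rw [this]
  exact isClosed_commutingTuples.inter <| isClosed_iInter fun p => isClosed_iInter fun _ =>
    isClosed_le continuous_const (continuous_defect q p)

/-- `D_q(H)` is a neighbourhood of each of its points among the commuting tuples. -/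
theorem eventually_mem_openPolydomain (hq : ∀ i, IsPositiveRegular (q i)) {X : Tuple n H}
    (hX : X ∈ openPolydomain H q) :
    ∀ᶠ Y in nhds X, Y ∈ commutingTuples n H → Y ∈ openPolydomain H q := by
  obtain ⟨c, hc, hcX⟩ := exists_smul_one_le (IsStrictlyPositive.iff_of_unital.2 hX.2)
  have hfin : {p : Fin k → ℕ | ∀ i, p i ≤ 1}.Finite := Set.finite_Iic (fun _ => 1)
  have hnear : ∀ p ∈ {p : Fin k → ℕ | ∀ i, p i ≤ 1}, ∀ᶠ Y in nhds X,
      (c / 2) • (1 : H →L[ℂ] H) ≤ defect q Y p 1 := by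
    intro p hp
    have hd := (continuous_defect (H := H) q p).continuousAt (x := X)
    filter_upwards [Metric.tendsto_nhds.1 hd (c / 2) (half_pos hc)] with Y hY
    rw [dist_eq_norm] at hY
    -- Norm closeness becomes an order bound through `-‖a‖ ≤ a`, valid for self-adjoint `a`.
    have h₁ := ((defect_isSelfAdjoint hq Y p).sub
      (defect_isSelfAdjoint hq X p)).neg_algebraMap_norm_le_self
    rw [Algebra.algebraMap_eq_smul_one] at h₁
    have h₂ : ‖defect q Y p 1 - defect q X p 1‖ • (1 : H →L[ℂ] H) ≤ (c / 2) • 1 :=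
      smul_le_smul_of_nonneg_right hY.le zero_le_one
    have h₃ := hcX.trans (defect_one_le hq hX.1 p hp)
    calc (c / 2) • (1 : H →L[ℂ] H) = c • 1 + -((c / 2) • 1) := by
          rw [← sub_eq_add_neg, ← sub_smul, sub_half]
      _ ≤ defect q X p 1 + (defect q Y p 1 - defect q X p 1) :=
          add_le_add h₃ ((neg_le_neg h₂).trans h₁)
      _ = defect q Y p 1 := add_sub_cancel _ _
  filter_upwards [(Set.Finite.eventually_all hfin).2 hnear] with Y hY hYc
  exact ⟨⟨hYc, fun p hp => (smul_nonneg (half_pos hc).le zero_le_one).trans (hY p hp)⟩,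
    isStrictlyPositive_of_smul_one_le (half_pos hc) (hY _ fun _ => le_rfl)⟩

theorem isRelOpen_openPolydomain (hq : ∀ i, IsPositiveRegular (q i)) :
    IsRelOpen (commutingTuples n H) (openPolydomain H q) := by
  -- This is the largest open set whose trace on the commuting tuples lies in `D_q(H)`.
  refine ⟨interior {Y | Y ∈ commutingTuples n H → Y ∈ openPolydomain H q}, isOpen_interior, ?_⟩
  ext X
  exact ⟨fun hX => ⟨mem_interior_iff_mem_nhds.2 (eventually_mem_openPolydomain hq hX), hX.1.1⟩,
    fun hX => interior_subset hX.1 hX.2⟩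

theorem const_mem_openPolydisc {r : ℝ} (hr : r ∈ Set.Ico (0 : ℝ) 1) :
    (fun _ _ => (r : ℂ)) ∈ openPolydisc n :=
  fun _ _ => by simpa [abs_of_nonneg hr.1] using hr.2

theorem closure_openPolydomain (hq : ∀ i, IsPositiveRegular (q i)) :
    closure (openPolydomain H q) = closedPolydomain H q := by
  refine Set.Subset.antisymm
    (closure_minimal (fun X hX => hX.1) isClosed_closedPolydomain) fun X hX => ?_
  have hlim : Filter.Tendsto (fun r : ℝ => (r : ℂ) • X) (nhdsWithin 1 (Set.Iio 1)) (nhds X) := by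
    have : Continuous fun r : ℝ => (r : ℂ) • X := by fun_prop
    simpa using (this.tendsto 1).mono_left nhdsWithin_le_nhds
  refine mem_closure_of_tendsto hlim ?_
  filter_upwards [Ioo_mem_nhdsLT (zero_lt_one (α := ℝ))] with r hr
  exact scale_mem_openPolydomain_of_mem_closedPolydomain hq hX
    (const_mem_openPolydisc ⟨hr.1.le, hr.2⟩)

/-- Every point of `D_q(H)` is a proper multiple of another one. -/
theorem exists_smul_eq_of_mem_openPolydomain (hq : ∀ i, IsPositiveRegular (q i)) {X : Tuple n H}
    (hX : X ∈ openPolydomain H q) :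
    ∃ r ∈ Set.Ico (0 : ℝ) 1, ∃ Y ∈ openPolydomain H q, (r : ℂ) • Y = X := by
  have hlim : Filter.Tendsto (fun r : ℝ => ((r : ℂ)⁻¹) • X) (nhdsWithin 1 (Set.Iio 1))
      (nhds X) := by
    have : ContinuousAt (fun r : ℝ => ((r : ℂ)⁻¹) • X) 1 :=
      (Complex.continuous_ofReal.continuousAt.inv₀ (by simp)).smul continuousAt_const
    simpa using this.tendsto.mono_left nhdsWithin_le_nhds
  obtain ⟨r, hr, hmem⟩ := (Filter.Eventually.and
    (Ioo_mem_nhdsLT (zero_lt_one (α := ℝ)))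
    (hlim.eventually (eventually_mem_openPolydomain hq hX))).exists
  refine ⟨r, ⟨hr.1.le, hr.2⟩, _, hmem (scale_mem_commutingTuples hX.1.1 _), ?_⟩
  rw [smul_smul, mul_inv_cancel₀ (by exact_mod_cast hr.1.ne'), one_smul]

theorem isCompleteReinhardt_openPolydomain (hq : ∀ i, IsPositiveRegular (q i)) :
    IsCompleteReinhardt (openPolydomain H q) := by
  intro X hX z hz
  -- Multipliers of modulus `1` are allowed, so a factor `r < 1` is taken out of `X` to bring `z r`
  -- into the open polydisc.
  obtain ⟨r, hr, Y, hY, rfl⟩ := exists_smul_eq_of_mem_openPolydomain hq hX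
  rw [smul_eq_scale, scale_scale]
  refine scale_mem_openPolydomain_of_mem_closedPolydomain hq hY.1 fun i j => ?_
  have h := const_mem_openPolydisc (n := n) hr i j
  rw [Pi.mul_apply, Pi.mul_apply, norm_mul]
  exact (mul_le_of_le_one_left (norm_nonneg _) (hz i j)).trans_lt h

theorem isCompleteReinhardt_closedPolydomain (hq : ∀ i, IsPositiveRegular (q i)) :
    IsCompleteReinhardt (closedPolydomain H q) :=
  fun _ hX _ hz => scale_mem_closedPolydomain hq hX hz

theorem phi_zero {m : ℕ} {r : NCPoly m} (hr : IsPositiveRegular r) (Y : H →L[ℂ] H) :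
    phi r (fun _ => 0) Y = 0 := by
  rw [phi_apply]
  refine Finset.sum_eq_zero fun α hα => ?_
  induction α using FreeMonoid.inductionOn' with
  | one => exact absurd hr.constant (Finsupp.mem_support_iff.1 hα)
  | of_mul j α _ => simp [wordOp]

theorem zero_mem_openPolydomain (hq : ∀ i, IsPositiveRegular (q i)) :
    (0 : Tuple n H) ∈ openPolydomain H q := by
  have hdef : ∀ p : Fin k → ℕ, defect q (0 : Tuple n H) p 1 = 1 := by
    intro p
    have h : ∀ i, phi (q i) (0 : Fin (n i) → (H →L[ℂ] H)) = 0 := fun i => LinearMap.ext (phi_zero (hq i))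
    simp [defect, h]
  refine ⟨⟨fun _ _ _ _ _ => Commute.zero_left _, fun p _ => ?_⟩, ?_⟩
  · rw [hdef]; exact zero_le_one
  · rw [hdef]; exact ⟨zero_le_one, isUnit_one⟩

theorem isConnected_openPolydomain (hq : ∀ i, IsPositiveRegular (q i)) :
    IsConnected (openPolydomain H q) := by
  refine (StarConvex.isPathConnected (a := 0) ?_ (zero_mem_openPolydomain hq)).isConnected
  refine starConvex_zero_iff.2 fun X hX t ht₀ ht₁ => ?_
  exact isCompleteReinhardt_openPolydomain hq X hX (fun _ _ => (t : ℂ))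
    fun _ _ => by simpa [abs_of_nonneg ht₀] using ht₁

/-- The sandwiched `G` serves both `D_q(H)` and its closure: one inclusion only needs points of
`D_q(H)`, the other only membership in `D_q^-(H)`. -/
theorem openPolydomain_eq_biUnion_smul (hq : ∀ i, IsPositiveRegular (q i)) {G : Set (Tuple n H)}
    (h₁ : openPolydomain H q ⊆ G) (h₂ : G ⊆ closedPolydomain H q) :
    openPolydomain H q = ⋃ r ∈ Set.Ico (0 : ℝ) 1, (r : ℂ) • G := by
  refine Set.Subset.antisymm (fun X hX => ?_) (Set.iUnion₂_subset fun r hr => ?_)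
  · obtain ⟨r, hr, Y, hY, rfl⟩ := exists_smul_eq_of_mem_openPolydomain hq hX
    exact Set.mem_biUnion hr ⟨Y, h₁ hY, rfl⟩
  · rintro _ ⟨X, hX, rfl⟩
    exact scale_mem_openPolydomain_of_mem_closedPolydomain hq (h₂ hX) (const_mem_openPolydisc hr)

theorem openPolydomain_eq_biUnion_scale (hq : ∀ i, IsPositiveRegular (q i)) {G : Set (Tuple n H)}
    (h₁ : openPolydomain H q ⊆ G) (h₂ : G ⊆ closedPolydomain H q) :
    openPolydomain H q = ⋃ z ∈ openPolydisc n, scale z '' G := by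
  refine Set.Subset.antisymm (fun X hX => ?_) (Set.iUnion₂_subset fun z hz => ?_)
  · obtain ⟨r, hr, Y, hY, rfl⟩ := exists_smul_eq_of_mem_openPolydomain hq hX
    exact Set.mem_biUnion (const_mem_openPolydisc hr) ⟨Y, h₁ hY, rfl⟩
  · rintro _ ⟨X, hX, rfl⟩
    exact scale_mem_openPolydomain_of_mem_closedPolydomain hq (h₂ hX) hz

end Polydomain

end RegularPolydomain

theorem mainTheorem11 {k : ℕ} (n : Fin k → ℕ)
    (q : (i : Fin k) → RegularPolydomain.NCPoly (n i))
    (hq : ∀ i, RegularPolydomain.IsPositiveRegular (q i))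
    (H : Type*) [NormedAddCommGroup H] [InnerProductSpace ℂ H] [CompleteSpace H] :
    (RegularPolydomain.IsRelOpen (RegularPolydomain.commutingTuples n H)
        (RegularPolydomain.openPolydomain H q) ∧
      closure (RegularPolydomain.openPolydomain H q) =
        RegularPolydomain.closedPolydomain H q) ∧
    (RegularPolydomain.IsCompleteReinhardtDomain (RegularPolydomain.openPolydomain H q) ∧
      RegularPolydomain.openPolydomain H q =
        ⋃ z ∈ RegularPolydomain.closedPolydisc n,
          RegularPolydomain.scale z '' RegularPolydomain.openPolydomain H q ∧
      RegularPolydomain.openPolydomain H q =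
        ⋃ z ∈ RegularPolydomain.openPolydisc n,
          RegularPolydomain.scale z '' closure (RegularPolydomain.openPolydomain H q) ∧
      RegularPolydomain.openPolydomain H q =
        ⋃ z ∈ RegularPolydomain.openPolydisc n,
          RegularPolydomain.scale z '' RegularPolydomain.openPolydomain H q ∧
      RegularPolydomain.openPolydomain H q =
        ⋃ r ∈ Set.Ico (0 : ℝ) 1, (r : ℂ) • RegularPolydomain.openPolydomain H q ∧
      RegularPolydomain.openPolydomain H q =
        ⋃ r ∈ Set.Ico (0 : ℝ) 1, (r : ℂ) • closure (RegularPolydomain.openPolydomain H q)) ∧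
    (RegularPolydomain.IsCompleteReinhardt (closure (RegularPolydomain.openPolydomain H q)) ∧
      closure (RegularPolydomain.openPolydomain H q) =
        ⋃ z ∈ RegularPolydomain.closedPolydisc n,
          RegularPolydomain.scale z '' closure (RegularPolydomain.openPolydomain H q) ∧
      closure (RegularPolydomain.openPolydomain H q) =
        ⋃ r ∈ Set.Icc (0 : ℝ) 1, (r : ℂ) • closure (RegularPolydomain.openPolydomain H q)) := by
  have hcl := RegularPolydomain.closure_openPolydomain (H := H) hq
  have hsub : RegularPolydomain.openPolydomain H q ⊆ RegularPolydomain.closedPolydomain H q :=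
    fun _ hX => hX.1
  rw [hcl]
  exact ⟨⟨RegularPolydomain.isRelOpen_openPolydomain hq, rfl⟩,
    ⟨⟨RegularPolydomain.isRelOpen_openPolydomain hq,
        RegularPolydomain.isConnected_openPolydomain hq,
        RegularPolydomain.isCompleteReinhardt_openPolydomain hq⟩,
      (RegularPolydomain.isCompleteReinhardt_openPolydomain hq).eq_biUnion_scale,
      RegularPolydomain.openPolydomain_eq_biUnion_scale hq hsub subset_rfl,
      RegularPolydomain.openPolydomain_eq_biUnion_scale hq subset_rfl hsub,
      RegularPolydomain.openPolydomain_eq_biUnion_smul hq subset_rfl hsub,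
      RegularPolydomain.openPolydomain_eq_biUnion_smul hq hsub subset_rfl⟩,
    RegularPolydomain.isCompleteReinhardt_closedPolydomain hq,
    (RegularPolydomain.isCompleteReinhardt_closedPolydomain hq).eq_biUnion_scale,
    (RegularPolydomain.isCompleteReinhardt_closedPolydomain hq).eq_biUnion_smul⟩
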